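/- Let $A$ and $B$ be (not necessarily unital) complex C*-algebras and let $\varphi\colon A\to B$ be a ($\mathbb{C}$-)linear map. Say that $\varphi$ is *positive* if $\varphi(a)\ge 0$ for every $a\ge 0$ in $A$; that $\varphi$ is *completely positive* if for every $n\in\mathbb{N}$ the entrywise amplification $\varphi^{(n)}\colon M_n(A)\to M_n(B)$, $(a_{ij})\mapsto(\varphi(a_{ij}))$, is positive; that $\varphi$ has *order zero* if $\varphi(a)\varphi(b)=0$ for all positive elements $a,b\in A$ with $ab=0$; and that $\varphi$ *preserves zero-products* if $\varphi(a)\varphi(b)=0$ for all $a,b\in A$ with $ab=0$. Then $\varphi$ is completely positive and has order zero if and only if $\varphi$ is positive and preserves zero-products. In particular, if $\varphi$ is positive and preserves zero-products, then $\varphi$ is completely positive. -/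

import Mathlib

/-- A map preserves zero-products if `a * b = 0` implies `φ a * φ b = 0`. -/
def PreservesZeroProducts {A B : Type*} [NonUnitalCStarAlgebra A] [NonUnitalCStarAlgebra B]
    (φ : A →ₗ[ℂ] B) : Prop :=
  ∀ a b : A, a * b = 0 → φ a * φ b = 0

/-- A linear map between C⋆-algebras is positive if it maps positive elements to positive
elements. -/
def IsPositiveMap {A B : Type*} [NonUnitalCStarAlgebra A] [PartialOrder A] [StarOrderedRing A]
    [NonUnitalCStarAlgebra B] [PartialOrder B] [StarOrderedRing B] (φ : A →ₗ[ℂ] B) : Prop :=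
  ∀ a : A, 0 ≤ a → 0 ≤ φ a

/-- A linear map is `n`-positive if its entrywise amplification `Mₙ(A) → Mₙ(B)` maps positive
elements of the C⋆-algebra `Mₙ(A)` to positive elements of the C⋆-algebra `Mₙ(B)`. -/
def IsNPositiveMap {A B : Type*} [NonUnitalCStarAlgebra A] [PartialOrder A] [StarOrderedRing A]
    [NonUnitalCStarAlgebra B] [PartialOrder B] [StarOrderedRing B] (n : ℕ) (φ : A →ₗ[ℂ] B) :
    Prop :=
  ∀ M : CStarMatrix (Fin n) (Fin n) A, 0 ≤ M → 0 ≤ M.map φ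

/-- A linear map is completely positive if it is `n`-positive for every `n`. -/
def IsCompletelyPositiveMap {A B : Type*} [NonUnitalCStarAlgebra A] [PartialOrder A]
    [StarOrderedRing A] [NonUnitalCStarAlgebra B] [PartialOrder B] [StarOrderedRing B]
    (φ : A →ₗ[ℂ] B) : Prop :=
  ∀ n : ℕ, IsNPositiveMap n φ

/-- A linear map has order zero if it preserves zero-products among positive elements. -/
def IsOrderZeroMap {A B : Type*} [NonUnitalCStarAlgebra A] [PartialOrder A] [StarOrderedRing A]
    [NonUnitalCStarAlgebra B] (φ : A →ₗ[ℂ] B) : Prop :=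
  ∀ a b : A, 0 ≤ a → 0 ≤ b → a * b = 0 → φ a * φ b = 0

/-- Complete positivity as defined here agrees with Mathlib's bundled completely positive maps. -/
theorem isCompletelyPositiveMap_iff {A B : Type*} [NonUnitalCStarAlgebra A] [PartialOrder A]
    [StarOrderedRing A] [NonUnitalCStarAlgebra B] [PartialOrder B] [StarOrderedRing B]
    (φ : A →ₗ[ℂ] B) :
    IsCompletelyPositiveMap φ ↔ ∃ ψ : CompletelyPositiveMap A B, ψ.toLinearMap = φ := by
  constructor
  · intro h
    exact ⟨{ φ with map_cstarMatrix_nonneg' := h }, rfl⟩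
  · rintro ⟨ψ, rfl⟩
    exact ψ.map_cstarMatrix_nonneg'

/-! For a continuous zero-product preserving `φ` the key identity is `φ (a * b) * φ c = φ a * φ (b *
c)`. By linearity `b ≥ 0` suffices. On continuous functions of `b`, the bilinear map `W f g = φ (a
f) * φ (g c)` vanishes when `f * g = 0`, which forces `W h 1 = W 1 h`
(`apply_one_right_eq_apply_one_left`).

Let `φ` also be positive and let `X` be the image of a positive matrix `star N * N`. Along an
approximate unit `e`, the identity makes `X * diag (φ e)` converge to `star (N.map φ) * N.map φ ≥
0`. Since `diag (φ e)` is positive, bounded and asymptotically supports `X`, the negative part of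
`X` vanishes (`nonneg_of_tendsto_mul_nonneg`).

Conversely, if `a * b = 0`, order zero gives `φ (star a * a) * φ (b * star b) = 0`, and 2-positivity
strips the factors `star a` and `star b` (`IsNPositiveMap.map_mul_eq_zero`). -/

open Filter Topology

/-- The sum of `W (u i) (v i)` over an index set on which the off-diagonal terms vanish. -/
theorem LinearMap.apply_sum_sum_of_offDiag_eq_zero {R M N P ι : Type*} [CommSemiring R]
    [AddCommMonoid M] [AddCommMonoid N] [AddCommMonoid P] [Module R M] [Module R N] [Module R P]
    (W : M →ₗ[R] N →ₗ[R] P) (s : Finset ι) (u : ι → M) (v : ι → N)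
    (h : ∀ i ∈ s, ∀ j ∈ s, i ≠ j → W (u i) (v j) = 0) :
    W (∑ i ∈ s, u i) (∑ j ∈ s, v j) = ∑ i ∈ s, W (u i) (v i) := by
  rw [map_sum W, LinearMap.sum_apply]
  refine Finset.sum_congr rfl fun i hi => ?_
  rw [map_sum]
  exact Finset.sum_eq_single i (fun j hj hji => h i hi j hj hji.symm) (fun hn => absurd hi hn)

/-! ### Bilinear maps on `C(K, ℝ)` vanishing on zero-products -/

namespace ContinuousMap

variable {K : Type*} [TopologicalSpace K]

/-- The function `h + 1 - k` truncated to `[0, 1]`. -/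
def ramp (h : C(K, ℝ)) (k : ℕ) : C(K, ℝ) where
  toFun x := max 0 (min 1 (h x + 1 - k))

/-- The bump function obtained as the difference of consecutive ramps. -/
def bump (h : C(K, ℝ)) (k : ℕ) : C(K, ℝ) := ramp h k - ramp h (k + 1)

theorem ramp_apply (h : C(K, ℝ)) (k : ℕ) (x : K) :
    ramp h k x = max 0 (min 1 (h x + 1 - k)) := rfl

theorem ramp_mem_Icc (h : C(K, ℝ)) (k : ℕ) (x : K) : ramp h k x ∈ Set.Icc (0 : ℝ) 1 := by
  simp [ramp_apply]

theorem ramp_succ_le (h : C(K, ℝ)) (k : ℕ) (x : K) : ramp h (k + 1) x ≤ ramp h k x := by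
  simp only [ramp_apply, Nat.cast_add, Nat.cast_one]
  gcongr
  linarith

/-- Each ramp is identically 1 wherever the next one is nonzero; all orthogonality relations below
come from this. -/
theorem ramp_succ_eq_zero_or_ramp_eq_one (h : C(K, ℝ)) (k : ℕ) (x : K) :
    ramp h (k + 1) x = 0 ∨ ramp h k x = 1 := by
  simp only [ramp_apply, Nat.cast_add, Nat.cast_one]
  rcases le_total (h x) k with hk | hk
  · left
    exact max_eq_left ((min_le_right _ _).trans (by linarith))
  · right
    rw [min_eq_left (by linarith)]
    exact max_eq_right zero_le_one

theorem ramp_antitone (h : C(K, ℝ)) (x : K) : Antitone fun k => ramp h k x :=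
  antitone_nat_of_succ_le fun k => ramp_succ_le h k x

theorem bump_apply (h : C(K, ℝ)) (k : ℕ) (x : K) :
    bump h k x = ramp h k x - ramp h (k + 1) x := rfl

theorem bump_nonneg (h : C(K, ℝ)) (k : ℕ) (x : K) : 0 ≤ bump h k x :=
  sub_nonneg.mpr (ramp_succ_le h k x)

theorem ramp_mul_bump_eq_zero (h : C(K, ℝ)) {i j : ℕ} (hij : i + 2 ≤ j) :
    ramp h j * bump h i = 0 := by
  ext x
  simp only [mul_apply, bump_apply, zero_apply, mul_eq_zero]
  rcases ramp_succ_eq_zero_or_ramp_eq_one h (i + 1) x with h1 | h1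
  · left
    exact le_antisymm (h1 ▸ ramp_antitone h x hij) (ramp_mem_Icc h j x).1
  · right
    have h2 := ramp_succ_le h i x
    have h3 := (ramp_mem_Icc h i x).2
    linarith

theorem bump_mul_bump_eq_zero (h : C(K, ℝ)) {i j : ℕ} (hij : i + 2 ≤ j ∨ j + 2 ≤ i) :
    bump h i * bump h j = 0 := by
  rcases hij with hij | hij
  · rw [mul_comm, bump, sub_mul, ramp_mul_bump_eq_zero h hij,
      ramp_mul_bump_eq_zero h (by omega), sub_zero]
  · rw [bump, sub_mul, ramp_mul_bump_eq_zero h hij,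
      ramp_mul_bump_eq_zero h (by omega), sub_zero]

theorem ramp_mul_one_sub_ramp_eq_zero (h : C(K, ℝ)) (k : ℕ) :
    ramp h (k + 1) * (1 - ramp h k) = 0 := by
  ext x
  simp only [mul_apply, sub_apply, one_apply, zero_apply, mul_eq_zero]
  rcases ramp_succ_eq_zero_or_ramp_eq_one h k x with h1 | h1
  · exact .inl h1
  · exact .inr (by rw [h1, sub_self])

theorem sum_ramp_succ {h : C(K, ℝ)} (hh : 0 ≤ h) {n : ℕ} (hn : ∀ x, h x ≤ n) :
    ∑ k ∈ Finset.range n, ramp h (k + 1) = h := by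
  have key : ∀ (t : ℝ), 0 ≤ t → ∀ m : ℕ,
      ∑ k ∈ Finset.range m, max 0 (min 1 (t - k)) = min t m := by
    intro t ht m
    induction m with
    | zero => simp [ht]
    | succ m ih =>
      rw [Finset.sum_range_succ, ih, Nat.cast_add, Nat.cast_one]
      grind
  ext x
  rw [ContinuousMap.sum_apply]
  have := key (h x) (hh x) n
  rw [min_eq_left (hn x)] at this
  rw [← this]
  refine Finset.sum_congr rfl fun k _ => ?_
  rw [ramp_apply]
  push_cast
  congr 2
  ring

variable {E : Type*} [NormedAddCommGroup E] [NormedSpace ℝ E]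

/-- Only the overlap of a ramp with its complement survives: `1 - ramp h k` is orthogonal to `ramp h
(k + 1)`, and `ramp h (k + 2)` to `bump h k`. -/
theorem apply_ramp_one_sub_ramp (W : C(K, ℝ) →ₗ[ℝ] C(K, ℝ) →ₗ[ℝ] E)
    (hW : ∀ f g, f * g = 0 → W f g = 0) (h : C(K, ℝ)) (k : ℕ) :
    W (ramp h (k + 1)) (1 - ramp h (k + 1)) = W (bump h (k + 1)) (bump h k) := by
  have h1 : (1 : C(K, ℝ)) - ramp h (k + 1) = bump h k + (1 - ramp h k) := by
    rw [bump]; abel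
  have h2 : ramp h (k + 1) = bump h (k + 1) + ramp h (k + 2) := by
    rw [bump]; abel
  rw [h1, map_add, hW _ _ (ramp_mul_one_sub_ramp_eq_zero h k), add_zero]
  conv_lhs => rw [h2]
  rw [map_add, LinearMap.add_apply, hW _ _ (ramp_mul_bump_eq_zero h le_rfl), add_zero]

variable [CompactSpace K]

/-- Bumps are nonnegative, and over an initial segment of indices their sum telescopes to a
difference of two ramps. -/
theorem norm_sum_bump_le_one (h : C(K, ℝ)) (s : Finset ℕ) : ‖∑ k ∈ s, bump h k‖ ≤ 1 := by
  rw [ContinuousMap.norm_le _ zero_le_one]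
  intro x
  obtain ⟨n, hn⟩ := s.exists_nat_subset_range
  rw [ContinuousMap.sum_apply, Real.norm_of_nonneg (Finset.sum_nonneg fun k _ => bump_nonneg h k x)]
  calc ∑ k ∈ s, bump h k x ≤ ∑ k ∈ Finset.range n, bump h k x :=
        Finset.sum_le_sum_of_subset_of_nonneg hn fun k _ _ => bump_nonneg h k x
    _ = ramp h 0 x - ramp h n x := by
        simp only [bump_apply]
        exact Finset.sum_range_sub' (fun k => ramp h k x) n
    _ ≤ 1 := by
        have h1 := (ramp_mem_Icc h 0 x).2
        have h2 := (ramp_mem_Icc h n x).1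
        linarith

theorem norm_sum_bump_succ_le_one (h : C(K, ℝ)) (s : Finset ℕ) :
    ‖∑ k ∈ s, bump h (k + 1)‖ ≤ 1 := by
  simpa using norm_sum_bump_le_one h (s.map (addRightEmbedding 1))

theorem norm_sum_bump_succ_bump_le (W : C(K, ℝ) →ₗ[ℝ] C(K, ℝ) →ₗ[ℝ] E) {C : ℝ}
    (hC : ∀ f g, ‖W f g‖ ≤ C * ‖f‖ * ‖g‖) (hC0 : 0 ≤ C)
    (hW : ∀ f g, f * g = 0 → W f g = 0) (h : C(K, ℝ)) (n : ℕ) :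
    ‖∑ k ∈ Finset.range n, W (bump h (k + 1)) (bump h k)‖ ≤ 3 * C := by
  -- Distinct `i`, `j` congruent mod 3 have `i + 1` and `j` at least 2 apart, so cross terms vanish
  -- and each class costs a single application of `hC`. Hence the bound does not depend on `n`.
  rw [← Finset.sum_fiberwise_of_maps_to (g := fun k => k % 3) (t := Finset.range 3)
    (fun k _ => Finset.mem_range.mpr (Nat.mod_lt k (by norm_num)))]
  calc _ ≤ ∑ _r ∈ Finset.range 3, C := by
        refine norm_sum_le_of_le _ fun r _ => ?_
        rw [← LinearMap.apply_sum_sum_of_offDiag_eq_zero W _ (fun k => bump h (k + 1)) (bump h)]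
        · refine (hC _ _).trans ?_
          have h1 := norm_sum_bump_succ_le_one h {k ∈ Finset.range n | k % 3 = r}
          have h2 := norm_sum_bump_le_one h {k ∈ Finset.range n | k % 3 = r}
          calc _ ≤ C * 1 * 1 := by gcongr
            _ = C := by ring
        · intro i hi j hj hij
          simp only [Finset.mem_filter] at hi hj
          exact hW _ _ (bump_mul_bump_eq_zero h (by omega))
    _ = 3 * C := by simp

/-- A bounded bilinear map on `C(K, ℝ)` that vanishes on zero-products satisfies
`W h 1 = W 1 h`. -/
theorem apply_one_right_eq_apply_one_left (W : C(K, ℝ) →ₗ[ℝ] C(K, ℝ) →ₗ[ℝ] E) {C : ℝ}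
    (hC : ∀ f g, ‖W f g‖ ≤ C * ‖f‖ * ‖g‖) (hC0 : 0 ≤ C)
    (hW : ∀ f g, f * g = 0 → W f g = 0) {h : C(K, ℝ)} (hh : 0 ≤ h) :
    W h 1 = W 1 h := by
  have bound : ∀ h : C(K, ℝ), 0 ≤ h → ‖W h 1 - W 1 h‖ ≤ 6 * C := by
    intro h hh
    obtain ⟨n, hn⟩ := exists_nat_ge ‖h‖
    have hsum := sum_ramp_succ hh (n := n) fun x =>
      (le_abs_self _).trans ((h.norm_coe_le_norm x).trans hn)
    have e1 := norm_sum_bump_succ_bump_le W hC hC0 hW h n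
    have e2 := norm_sum_bump_succ_bump_le W.flip
      (fun f g => (hC g f).trans_eq (by ring)) hC0
      (fun f g hfg => hW g f (by rw [mul_comm, hfg])) h n
    -- For each ramp `r`, `W r 1 - W 1 r = W r (1 - r) - W (1 - r) r`, as the terms `W r r` cancel.
    have key : W h 1 - W 1 h =
        ∑ k ∈ Finset.range n, W (bump h (k + 1)) (bump h k) -
        ∑ k ∈ Finset.range n, W.flip (bump h (k + 1)) (bump h k) := by
      conv_lhs => rw [← hsum]
      rw [map_sum, map_sum, LinearMap.sum_apply, ← Finset.sum_sub_distrib,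
        ← Finset.sum_sub_distrib]
      refine Finset.sum_congr rfl fun k _ => ?_
      rw [← apply_ramp_one_sub_ramp W hW, ← apply_ramp_one_sub_ramp W.flip
        (fun f g hfg => hW g f (by rw [mul_comm, hfg]))]
      simp only [map_sub, LinearMap.flip_apply]
      abel
    rw [key]
    exact (norm_sub_le _ _).trans (by linarith)
  rw [← sub_eq_zero, ← norm_le_zero_iff]
  -- The bound `6 * C` is independent of `h`, while the left side scales linearly in `h`.
  by_contra! hpos
  obtain ⟨N, hN⟩ := exists_nat_gt (6 * C / ‖W h 1 - W 1 h‖)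
  rw [div_lt_iff₀ hpos] at hN
  have := bound ((N : ℝ) • h) (smul_nonneg N.cast_nonneg hh)
  rw [map_smul, map_smul, LinearMap.smul_apply, ← smul_sub, norm_smul, Real.norm_natCast] at this
  linarith

end ContinuousMap

/-! ### The identity `φ (a * b) * φ c = φ a * φ (b * c)` -/

namespace Unitization

theorem inr_snd_inr_mul {A : Type*} [NonUnitalCStarAlgebra A] (a : A) (F : Unitization ℂ A) :
    ((((a : Unitization ℂ A) * F).snd : A) : Unitization ℂ A) = a * F := by
  ext <;> simp

theorem inr_snd_mul_inr {A : Type*} [NonUnitalCStarAlgebra A] (a : A) (F : Unitization ℂ A) :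
    (((F * (a : Unitization ℂ A)).snd : A) : Unitization ℂ A) = F * a := by
  ext <;> simp

theorem norm_snd_inr_mul_le {A : Type*} [NonUnitalCStarAlgebra A] (a : A)
    (F : Unitization ℂ A) : ‖((a : Unitization ℂ A) * F).snd‖ ≤ ‖a‖ * ‖F‖ := by
  rw [← norm_inr (𝕜 := ℂ), inr_snd_inr_mul, ← norm_inr (𝕜 := ℂ) a]
  exact norm_mul_le _ _

theorem norm_snd_mul_inr_le {A : Type*} [NonUnitalCStarAlgebra A] (a : A)
    (F : Unitization ℂ A) : ‖(F * (a : Unitization ℂ A)).snd‖ ≤ ‖F‖ * ‖a‖ := by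
  rw [← norm_inr (𝕜 := ℂ), inr_snd_mul_inr, ← norm_inr (𝕜 := ℂ) a]
  exact norm_mul_le _ _

end Unitization

section ZeroProducts

variable {A B : Type*} [NonUnitalCStarAlgebra A] [NonUnitalCStarAlgebra B]

theorem PreservesZeroProducts.map_mul_mul_map_of_nonneg [PartialOrder A] [StarOrderedRing A]
    {φ : A →ₗ[ℂ] B} (hφ : PreservesZeroProducts φ) (hc : Continuous φ) (a c : A) {b : A}
    (hb : 0 ≤ b) : φ (a * b) * φ c = φ a * φ (b * c) := by
  obtain ⟨M, hM0, hM⟩ : ∃ M : ℝ, 0 ≤ M ∧ ∀ x, ‖φ x‖ ≤ M * ‖x‖ :=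
    ⟨_, norm_nonneg _, (⟨φ, hc⟩ : A →L[ℂ] B).le_opNorm⟩
  have hb' : (0 : Unitization ℂ A) ≤ b := Unitization.inr_nonneg_iff.mpr hb
  have hsa : IsSelfAdjoint (b : Unitization ℂ A) := hb'.isSelfAdjoint
  let Φ := cfcHom (R := ℝ) hsa
  -- The constant function 1 maps to the unit of the unitization; multiplying by `a` or `c` returns
  -- to the ideal `A`, so `.snd` loses nothing.
  let W : C(spectrum ℝ (b : Unitization ℂ A), ℝ) →ₗ[ℝ] C(spectrum ℝ (b : Unitization ℂ A), ℝ)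
      →ₗ[ℝ] B :=
    LinearMap.mk₂ ℝ (fun f g => φ ((a : Unitization ℂ A) * Φ f).snd *
        φ (Φ g * (c : Unitization ℂ A)).snd)
      (fun f f' g => by simp only [map_add, mul_add, add_mul, Unitization.snd_add])
      (fun r f g => by
        simp only [map_smul, mul_smul_comm, Unitization.snd_smul, LinearMap.map_smul_of_tower,
          smul_mul_assoc])
      (fun f f' g => by simp only [map_add, mul_add, add_mul, Unitization.snd_add])
      (fun r f g => by
        simp only [map_smul, mul_smul_comm, Unitization.snd_smul, LinearMap.map_smul_of_tower,
          smul_mul_assoc])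
  have hW : ∀ f g, W f g = φ ((a : Unitization ℂ A) * Φ f).snd *
        φ (Φ g * (c : Unitization ℂ A)).snd := fun _ _ => rfl
  have hΦ : ∀ f, ‖Φ f‖ = ‖f‖ := norm_cfcHom (b : Unitization ℂ A) (ha := hsa)
  have h := ContinuousMap.apply_one_right_eq_apply_one_left W
    (C := (M * ‖a‖) * (M * ‖c‖)) (fun f g => ?_) (by positivity) (fun f g hfg => ?_)
    (h := .restrict _ (.id ℝ)) (fun x => spectrum_nonneg_of_nonneg hb' x.2)
  · have hid : Φ (.restrict _ (.id ℝ)) = b := cfcHom_id hsa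
    simpa only [hW, hid, map_one, mul_one, one_mul, Unitization.snd_inr,
      ← Unitization.inr_mul] using h
  · rw [hW]
    calc _ ≤ (M * (‖a‖ * ‖Φ f‖)) * (M * (‖Φ g‖ * ‖c‖)) := by
          refine norm_mul_le_of_le ((hM _).trans ?_) ((hM _).trans ?_)
          · gcongr; exact Unitization.norm_snd_inr_mul_le _ _
          · gcongr; exact Unitization.norm_snd_mul_inr_le _ _
      _ = _ := by rw [hΦ, hΦ]; ring
  · refine hφ _ _ (Unitization.inr_injective (R := ℂ) ?_)
    rw [Unitization.inr_mul, Unitization.inr_snd_inr_mul, Unitization.inr_snd_mul_inr, mul_assoc,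
      ← mul_assoc (Φ f), ← map_mul, hfg, map_zero, zero_mul, mul_zero, Unitization.inr_zero]

/-- A continuous zero-product preserving linear map `φ` between C⋆-algebras satisfies
`φ (a * b) * φ c = φ a * φ (b * c)`. -/
theorem PreservesZeroProducts.map_mul_mul_map
    {φ : A →ₗ[ℂ] B} (hφ : PreservesZeroProducts φ) (hc : Continuous φ) (a b c : A) :
    φ (a * b) * φ c = φ a * φ (b * c) := by
  let := CStarAlgebra.spectralOrder A
  let := CStarAlgebra.spectralOrderedRing A
  have hb : b ∈ Submodule.span ℂ {x : A | 0 ≤ x} := by simp [CStarAlgebra.span_nonneg]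
  induction hb using Submodule.span_induction with
  | mem x hx => exact hφ.map_mul_mul_map_of_nonneg hc a c hx
  | zero => simp
  | add x y _ _ hx hy => simp only [mul_add, add_mul, map_add, hx, hy]
  | smul r x _ hx => simp only [mul_smul_comm, smul_mul_assoc, map_smul, hx]

end ZeroProducts

/-! ### Positivity through limits of products -/

/-- Writing `H e = star d * d` gives `‖H e * q‖ ^ 2 ≤ ‖H e‖ * ‖star q * H e * q‖`. -/
theorem tendsto_mul_of_tendsto_star_mul_mul {E ι : Type*} [NonUnitalCStarAlgebra E]
    [PartialOrder E] [StarOrderedRing E] {l : Filter ι} {H : ι → E} {C : ℝ}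
    (hH0 : ∀ᶠ e in l, 0 ≤ H e) (hHC : ∀ᶠ e in l, ‖H e‖ ≤ C) {q : E}
    (hq : Tendsto (fun e => star q * H e * q) l (𝓝 0)) :
    Tendsto (fun e => H e * q) l (𝓝 0) := by
  have h1 : Tendsto (fun e => C * ‖star q * H e * q‖) l (𝓝 0) := by
    simpa using (hq.norm).const_mul C
  have h2 : Tendsto (fun e => ‖H e * q‖ ^ 2) l (𝓝 0) := by
    refine squeeze_zero' (.of_forall fun _ => by positivity) ?_ h1
    filter_upwards [hH0, hHC] with e he0 heC
    obtain ⟨d, hd⟩ := CStarAlgebra.nonneg_iff_eq_star_mul_self.mp he0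
    have e1 : ‖H e‖ = ‖d‖ ^ 2 := by rw [hd, CStarRing.norm_star_mul_self, sq]
    have e2 : ‖star q * H e * q‖ = ‖d * q‖ ^ 2 := by
      rw [sq, ← CStarRing.norm_star_mul_self, hd, star_mul]
      simp only [mul_assoc]
    calc ‖H e * q‖ ^ 2 = ‖star d * (d * q)‖ ^ 2 := by rw [hd, mul_assoc]
      _ ≤ (‖star d‖ * ‖d * q‖) ^ 2 := by gcongr; exact norm_mul_le _ _
      _ = ‖H e‖ * ‖star q * H e * q‖ := by rw [e1, e2, norm_star, mul_pow]
      _ ≤ C * ‖star q * H e * q‖ := by gcongr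
  rw [tendsto_zero_iff_norm_tendsto_zero]
  simpa [Function.comp_def, Real.sqrt_sq] using (Real.continuous_sqrt.tendsto _).comp h2

/-- A self-adjoint `X` is nonnegative if its products with a bounded family of nonnegative
elements converge to a nonnegative element, and the family is asymptotically a left support
for `X`. -/
theorem nonneg_of_tendsto_mul_nonneg {E ι : Type*} [NonUnitalCStarAlgebra E]
    [PartialOrder E] [StarOrderedRing E] {l : Filter ι} [l.NeBot] {H : ι → E} {C : ℝ}
    (hH0 : ∀ᶠ e in l, 0 ≤ H e) (hHC : ∀ᶠ e in l, ‖H e‖ ≤ C) {X Z : E}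
    (hX : IsSelfAdjoint X) (hZ : 0 ≤ Z) (hXH : Tendsto (fun e => X * H e) l (𝓝 Z))
    (hsupp : ∀ q, Tendsto (fun e => H e * q) l (𝓝 0) → X * q = 0) : 0 ≤ X := by
  have hp0 : 0 ≤ X⁻ := CFC.negPart_nonneg X
  have hps : star X⁻ = X⁻ := hp0.isSelfAdjoint.star_eq
  have hXp : X⁻ * X = -(X⁻ * X⁻) := by
    conv_lhs => enter [2]; rw [← CFC.posPart_sub_negPart X]
    rw [mul_sub, CFC.negPart_mul_posPart, zero_sub]
  have hXp' : X * X⁻ = -(X⁻ * X⁻) := by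
    conv_lhs => enter [1]; rw [← CFC.posPart_sub_negPart X]
    rw [sub_mul, CFC.posPart_mul_negPart, zero_sub]
  set p := X⁻
  have hW0 : 0 ≤ p * Z * p := by simpa [hps] using star_left_conjugate_nonneg hZ p
  have h1 : Tendsto (fun e => p * (p * H e * p)) l (𝓝 (-(p * Z * p))) := by
    refine ((tendsto_const_nhds (x := p)).mul hXH |>.mul_const p).neg.congr fun e => ?_
    rw [← mul_assoc p X, hXp]
    noncomm_ring
  have h2 : Tendsto (fun e => (p * H e * p) * p) l (𝓝 (-(p * Z * p))) := by
    have := h1.star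
    rw [star_neg, hW0.isSelfAdjoint.star_eq] at this
    refine this.congr' ?_
    filter_upwards [hH0] with e he
    simp only [star_mul, hps, he.isSelfAdjoint.star_eq, mul_assoc]
  have h3 : Tendsto (fun e => p * (p * H e * p) * p) l (𝓝 (-(p * Z * p * p))) := by
    simpa using h1.mul_const p
  have h3' : Tendsto (fun e => p * (p * H e * p) * p) l (𝓝 (-(p * (p * Z * p)))) := by
    simpa [mul_assoc] using h2.const_mul p
  -- `p * (p * H e * p) * p` has both products as its limit, up to sign. So `p * Z * p * p` is a
  -- product of commuting positives, yet also minus a limit of positives, hence 0.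
  have hcomm : Commute (p * Z * p) p := neg_injective (tendsto_nhds_unique h3 h3')
  have h4 : 0 ≤ p * Z * p * p := hcomm.mul_nonneg hW0 hp0
  have h5 : 0 ≤ -(p * Z * p * p) := by
    refine ge_of_tendsto h3 ?_
    filter_upwards [hH0] with e he
    have := star_left_conjugate_nonneg he (p * p)
    simpa [hps, mul_assoc] using this
  have h6 : p * Z * p * p = 0 := le_antisymm (neg_nonneg.mp h5) h4
  rw [h6, neg_zero] at h3
  have h7 : X * (p * p) = 0 := by
    refine hsupp _ (tendsto_mul_of_tendsto_star_mul_mul hH0 hHC ?_)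
    simpa [hps, mul_assoc] using h3
  have h8 : p * p * p = 0 := by
    rw [← mul_assoc, hXp', neg_mul, neg_eq_zero] at h7
    exact h7
  have h9 : (p * p) = 0 := by
    rw [← CStarRing.star_mul_self_eq_zero_iff, star_mul, hps, ← mul_assoc, h8, zero_mul]
  have h10 : p = 0 := by
    rwa [← CStarRing.star_mul_self_eq_zero_iff, hps]
  exact (CFC.negPart_eq_zero_iff X).mp h10

theorem CStarAlgebra.exists_eq_star_mul_self {E : Type*} [NonUnitalCStarAlgebra E]
    [PartialOrder E] [StarOrderedRing E] {x : E} (hx : 0 ≤ x) : ∃ y, x = star y * y :=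
  CStarAlgebra.nonneg_iff_eq_star_mul_self.mp hx

/-! ### Diagonal matrices and entrywise limits -/

namespace CStarMatrix

/-- The ⋆-homomorphism sending `b` to the diagonal matrix with all diagonal entries `b`. -/
def diagonalHom (n B : Type*) [Fintype n] [DecidableEq n] [NonUnitalCStarAlgebra B] :
    B →⋆ₙₐ[ℂ] CStarMatrix n n B where
  toFun b := ofMatrix (Matrix.diagonal fun _ => b)
  map_smul' r b := by
    ext i j
    by_cases h : i = j <;> simp [ofMatrix_apply, h]
  map_zero' := congrArg ofMatrix Matrix.diagonal_zero
  map_add' b c := congrArg ofMatrix (Matrix.diagonal_add (fun _ : n => b) fun _ => c).symm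
  map_mul' b c := congrArg ofMatrix (Matrix.diagonal_mul_diagonal (fun _ : n => b) fun _ => c).symm
  map_star' b := congrArg ofMatrix (Matrix.diagonal_conjTranspose fun _ : n => b).symm

theorem tendsto_iff {n B ι : Type*} [NonUnitalCStarAlgebra B] {l : Filter ι}
    {F : ι → CStarMatrix n n B} {M : CStarMatrix n n B} :
    Tendsto F l (𝓝 M) ↔ ∀ i j, Tendsto (fun e => F e i j) l (𝓝 (M i j)) :=
  (tendsto_pi_nhds (A := fun _ : n => n → B)).trans
    (forall_congr' fun _ => tendsto_pi_nhds (A := fun _ : n => B))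

variable {n B : Type*} [Fintype n] [DecidableEq n] [NonUnitalCStarAlgebra B]

theorem diagonalHom_mul_apply (b : B) (M : CStarMatrix n n B) (i j : n) :
    (diagonalHom n B b * M) i j = b * M i j :=
  Matrix.diagonal_mul (fun _ => b) M i j

theorem mul_diagonalHom_apply (b : B) (M : CStarMatrix n n B) (i j : n) :
    (M * diagonalHom n B b) i j = M i j * b :=
  Matrix.mul_diagonal (fun _ => b) M i j

end CStarMatrix

/-! ### Positive maps and the two implications -/

section PositiveMaps

variable {A B : Type*} [NonUnitalCStarAlgebra A] [PartialOrder A] [StarOrderedRing A]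
  [NonUnitalCStarAlgebra B] [PartialOrder B] [StarOrderedRing B] {φ : A →ₗ[ℂ] B}

theorem IsPositiveMap.exists_positiveLinearMap (hφ : IsPositiveMap φ) :
    ∃ f : A →ₚ[ℂ] B, ⇑f = φ := by
  refine ⟨{ φ with monotone' := fun a b hab => ?_ }, rfl⟩
  simpa using hφ (b - a) (sub_nonneg.mpr hab)

theorem IsPositiveMap.continuous (hφ : IsPositiveMap φ) : Continuous φ := by
  obtain ⟨f, hf⟩ := hφ.exists_positiveLinearMap
  exact hf ▸ map_continuous f

theorem IsPositiveMap.map_star (hφ : IsPositiveMap φ) (a : A) : φ (star a) = star (φ a) := by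
  obtain ⟨f, hf⟩ := hφ.exists_positiveLinearMap
  exact hf ▸ StarHomClass.map_star f a

theorem IsCompletelyPositiveMap.isPositiveMap (hφ : IsCompletelyPositiveMap φ) :
    IsPositiveMap φ := by
  obtain ⟨ψ, rfl⟩ := (isCompletelyPositiveMap_iff φ).mp hφ
  exact fun a ha => map_nonneg ψ ha

/-- A positive zero-product preserving map is completely positive. -/
theorem PreservesZeroProducts.isCompletelyPositiveMap (hφ : PreservesZeroProducts φ)
    (hpos : IsPositiveMap φ) : IsCompletelyPositiveMap φ := by
  intro n M hM
  have hc := hpos.continuous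
  have hl := CStarAlgebra.increasingApproximateUnit A
  have := hl.neBot
  obtain ⟨N, rfl⟩ := CStarAlgebra.exists_eq_star_mul_self hM
  have hN : ∀ i j, (star N * N) i j = ∑ k, star (N k i) * N k j := fun i j => rfl
  have hlim : ∀ a b : A, Tendsto (fun e => φ (a * b) * φ e) (CStarAlgebra.approximateUnit A)
      (𝓝 (φ a * φ b)) := fun a b => by
    simp only [hφ.map_mul_mul_map hc]
    exact ((hc.tendsto _).comp (hl.tendsto_mul_left b)).const_mul _
  refine nonneg_of_tendsto_mul_nonneg (l := CStarAlgebra.approximateUnit A)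
    (H := fun e => CStarMatrix.diagonalHom (Fin n) B (φ e))
    (C := ‖(⟨φ, hc⟩ : A →L[ℂ] B)‖) (Z := star (N.map φ) * N.map φ) ?_ ?_ ?_
    (star_mul_self_nonneg _) ?_ ?_
  · filter_upwards [hl.eventually_nonneg] with e he
    exact map_nonneg _ (hpos e he)
  · filter_upwards [hl.eventually_norm] with e he
    exact (NonUnitalStarAlgHom.norm_apply_le _ _).trans
      ((⟨φ, hc⟩ : A →L[ℂ] B).unit_le_opNorm e he)
  · ext i j
    rw [CStarMatrix.star_apply, CStarMatrix.map_apply, CStarMatrix.map_apply, ← hpos.map_star,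
      ← CStarMatrix.star_apply, star_mul, star_star]
  · rw [CStarMatrix.tendsto_iff]
    intro i j
    simp only [CStarMatrix.mul_diagonalHom_apply, CStarMatrix.map_apply, hN, map_sum,
      Finset.sum_mul]
    have hZ : (star (N.map φ) * N.map φ) i j = ∑ k, φ (star (N k i)) * φ (N k j) := by
      simp only [hpos.map_star]
      rfl
    rw [hZ]
    exact tendsto_finsetSum _ fun k _ => hlim _ _
  · intro q hq
    rw [CStarMatrix.tendsto_iff] at hq
    -- Asymptotic annihilation by `φ e` passes to `φ (star b) * φ b`, the limit of `φ (star b * b) *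
    -- φ e`, and then to `φ b` by the C⋆-identity.
    have hker : ∀ (b : A) (k j : Fin n), φ b * q k j = 0 := by
      intro b k j
      have h1 := hq k j
      simp only [CStarMatrix.diagonalHom_mul_apply, CStarMatrix.zero_apply] at h1
      have h2 : φ (star b) * φ b * q k j = 0 := by
        refine tendsto_nhds_unique ((hlim (star b) b).mul_const (q k j)) ?_
        simpa [mul_assoc] using h1.const_mul (φ (star b * b))
      rw [← CStarRing.star_mul_self_eq_zero_iff, star_mul, ← hpos.map_star, mul_assoc,
        ← mul_assoc (φ (star b)), h2, mul_zero]
    ext i j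
    rw [CStarMatrix.mul_apply]
    exact Finset.sum_eq_zero fun k _ => hker _ k j

/-- If `φ` is `2`-positive, everything annihilated by `φ (star a * a)` is annihilated by `φ a`. -/
theorem IsNPositiveMap.map_mul_eq_zero (hφ : IsNPositiveMap 2 φ) (hc : Continuous φ)
    {a : A} {y : B} (h : φ (star a * a) * y = 0) : φ a * y = 0 := by
  have hl := CStarAlgebra.increasingApproximateUnit A
  have := hl.neBot
  refine tendsto_nhds_unique_of_eventuallyEq
    (((hc.tendsto _).comp (hl.tendsto_mul_right a)).mul_const y) tendsto_const_nhds ?_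
  filter_upwards [hl.eventually_star_eq] with e he
  -- `star R * R` has entries `e * a` and `star a * a` in its second column. Factoring its image as
  -- `star T * T`, the hypothesis makes the second column of `T` annihilate `y`.
  let R : CStarMatrix (Fin 2) (Fin 2) A := CStarMatrix.ofMatrix !![e, a; 0, 0]
  obtain ⟨T, hT⟩ := CStarAlgebra.exists_eq_star_mul_self (hφ _ (star_mul_self_nonneg R))
  have hentry : ∀ i j, φ (∑ k, star (R k i) * R k j) = ∑ k, star (T k i) * T k j := fun i j =>
    congrFun (congrFun hT i) j
  have h01 : φ (e * a) = ∑ k, star (T k 0) * T k 1 := by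
    rw [← hentry 0 1, Fin.sum_univ_two, ← he]
    simp [R]
  have h11 : φ (star a * a) = ∑ k, star (T k 1) * T k 1 := by
    rw [← hentry 1 1, Fin.sum_univ_two]
    simp [R]
  have hsum : ∑ k, star (T k 1 * y) * (T k 1 * y) = 0 := by
    rw [← mul_zero (star y), ← h, h11, Finset.sum_mul, Finset.mul_sum]
    simp only [star_mul, mul_assoc]
  rw [Finset.sum_eq_zero_iff_of_nonneg fun k _ => star_mul_self_nonneg _] at hsum
  change φ (e * a) * y = 0
  rw [h01, Finset.sum_mul]
  refine Finset.sum_eq_zero fun k hk => ?_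
  rw [mul_assoc, (CStarRing.star_mul_self_eq_zero_iff _).mp (hsum k hk), mul_zero]

/-- Completely positive order zero maps preserve zero-products. -/
theorem IsOrderZeroMap.preservesZeroProducts (hφ : IsOrderZeroMap φ)
    (hcp : IsCompletelyPositiveMap φ) : PreservesZeroProducts φ := by
  intro a b hab
  have hpos := hcp.isPositiveMap
  have h1 : φ (b * star b) * φ (star a * a) = 0 := by
    rw [← star_eq_zero, star_mul, ← hpos.map_star, ← hpos.map_star]
    simp only [star_mul, star_star]
    refine hφ _ _ (star_mul_self_nonneg a) (mul_star_self_nonneg b) ?_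
    rw [mul_assoc, ← mul_assoc a, hab, zero_mul, mul_zero]
  have h2 : φ (star b) * φ (star a * a) = 0 :=
    (hcp 2).map_mul_eq_zero hpos.continuous (by rwa [star_star])
  refine (hcp 2).map_mul_eq_zero hpos.continuous ?_
  rw [← star_eq_zero, star_mul, ← hpos.map_star, ← hpos.map_star, star_mul, star_star, h2]

end PositiveMaps

theorem corollary4p8 {A B : Type*}
    [NonUnitalCStarAlgebra A] [PartialOrder A] [StarOrderedRing A]
    [NonUnitalCStarAlgebra B] [PartialOrder B] [StarOrderedRing B]
    (φ : A →ₗ[ℂ] B) :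
    ((IsCompletelyPositiveMap φ ∧ IsOrderZeroMap φ) ↔
      (IsPositiveMap φ ∧ PreservesZeroProducts φ)) ∧
    (IsPositiveMap φ → PreservesZeroProducts φ → IsCompletelyPositiveMap φ) :=
  ⟨⟨fun ⟨hcp, h0⟩ => ⟨hcp.isPositiveMap, h0.preservesZeroProducts hcp⟩,
    fun ⟨hpos, hz⟩ => ⟨hz.isCompletelyPositiveMap hpos, fun a b _ _ hab => hz a b hab⟩⟩,
    fun hpos hz => hz.isCompletelyPositiveMap hpos⟩
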